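/- **Setting.** Alice and Bob share $n$ qubit pairs. The Bell states are $|B_{ab}\rangle=(Z^aX^b\otimes\mathbb 1)|\phi^+\rangle$ with phase bit $a$, amplitude bit $b$ and $|\phi^+\rangle=(|00\rangle+|11\rangle)/\sqrt2$. A state $\rho$ on the $n$ pairs is Bell-diagonal if it is diagonal in the basis of the tensor products $|B_x\rangle=\bigotimes_j|B_{x_j}\rangle$, $x\in(\{0,1\}^2)^n$; its eigenvalues are then described by the distribution $P_{X^n}$ with $\rho=\sum_x P_{X^n}(x)|B_x\rangle\langle B_x|$. *One-way hashing method.* One round on $k+1$ pairs: draw a uniformly random string $s=s_1\cdots s_{k+1}$ of two-bit symbols, and let $j^\star$ be the position of its first nonzero symbol (the first pair, if $s=0$). For each $j$ with $s_j=10$ both parties rotate their half of pair $j$ by $\pi/2$ around the $y$-axis; for each $j$ with $s_j=11$ Alice and Bob rotate theirs by $3\pi/2$ and $\pi/2$, respectively, around the $x$-axis. For each $j\ne j^\star$ with $s_j\neq00$ both parties apply a CNOT from pair $j$ to the target pair $j^\star$. Both measure pair $j^\star$ in the computational basis, discard it, and Alice sends her outcome to Bob. After all $r$ rounds, given the initial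 state, the strings and all outcomes, Bob applies single-qubit Pauli gates such that a largest eigenvalue of the (Bell-diagonal) state of the remaining pairs belongs to $|\phi^+\rangle^{\otimes(n-r)}$. The output $\rho'_{n-r}$ is the resulting state of the $n-r$ remaining pairs, averaged over strings and outcomes. *Entropy and distance.* For sub-normalized states, $\mathrm P(\rho,\sigma)=\sqrt{1-\mathrm F(\rho,\sigma)}$ is the purified distance, where $\mathrm F(\rho,\sigma)=\bigl(\|\sqrt\rho\sqrt\sigma\|_1+\sqrt{(1-\operatorname{Tr}\rho)(1-\operatorname{Tr}\sigma)}\bigr)^2$, and for sub-normalized distributions $\mathrm P(P,Q)=\sqrt{1-\mathrm F(P,Q)}$ with $\mathrm F(P,Q)=\bigl(\sum_x\sqrt{P(x)Q(x)}+\sqrt{(1-\sum_xP(x))(1-\sum_xQ(x))}\bigr)^2$. The smooth Hartley entropy is $$H_0^{\epsilon}(X^n)_P=\inf\bigl\{\log_2|\{x:Q(x)>0\}| \;:\; Q\text{ a sub-normalized distribution on }(\{0,1\}^2)^n,\ \mathrm P(P,Q)\le\epsilon\bigr\}.$$ Let $m^\epsilon$ be the largest $m\le n$ for which $r=n-m$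 rounds of the method applied to $\rho$ give $\mathrm P\bigl(\rho'_m,\,|\phi^+\rangle\langle\phi^+|^{\otimes m}\bigr)\le\epsilon$, and let $R^\epsilon=m^\epsilon/n$ be the rate. **Theorem.** Let $\rho$ be a normalized Bell-diagonal state on $n$ qubit pairs with eigenvalue distribution $P_{X^n}$. For all $0<\epsilon_1<1$, $0<\epsilon_2\le1$ and $\epsilon$ with $\epsilon_1+\epsilon_2\le\epsilon$, $$m^\epsilon\;\ge\; n-\bigl\lceil H_0^{\epsilon_1}(X^n)_P-2\log_2\epsilon_2\bigr\rceil \qquad\text{and}\qquad R^\epsilon\;\ge\;\frac{n-\bigl\lceil H_0^{\epsilon_1}(X^n)_P-2\log_2\epsilon_2\bigr\rceil}{n}.$$ -/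

import Mathlib

open scoped Matrix Kronecker MatrixOrder ComplexOrder

noncomputable section

namespace OneWayHashing

/-! ## Classical distributions: purified distance and smooth Hartley entropy -/

section Classical

variable {X : Type*} [Fintype X]

/-- Sub-normalized distributions on `X`. -/
def IsSubDistribution (P : X → ℝ) : Prop :=
  (∀ x, 0 ≤ P x) ∧ ∑ x, P x ≤ 1

/-- Generalized fidelity of two sub-normalized distributions. -/
def classicalFidelity (P Q : X → ℝ) : ℝ :=
  (∑ x, √(P x * Q x) + √((1 - ∑ x, P x) * (1 - ∑ x, Q x))) ^ 2

/-- Purified distance of two sub-normalized distributions. -/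
def classicalPurifiedDistance (P Q : X → ℝ) : ℝ :=
  √(1 - classicalFidelity P Q)

/-- The Hartley entropy `log₂ |{x : P x > 0}|`. -/
def hartleyEntropy (P : X → ℝ) : ℝ :=
  Real.logb 2 ({x | 0 < P x} : Set X).ncard

/-- The `ε`-ball of sub-normalized distributions around `P` in purified distance. -/
def classicalBall (ε : ℝ) (P : X → ℝ) : Set (X → ℝ) :=
  {Q | IsSubDistribution Q ∧ classicalPurifiedDistance P Q ≤ ε}

/-- The `ε`-smooth Hartley entropy `inf {H₀(Q) : Q ∈ B^ε(P)}`.  For normalized `P` and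
`0 ≤ ε < 1` the ball contains `P` and does not contain the zero distribution, so this is an
infimum of a nonempty set of nonnegative reals. -/
def smoothHartleyEntropy (ε : ℝ) (P : X → ℝ) : ℝ :=
  sInf (hartleyEntropy '' classicalBall ε P)

end Classical

/-! ## Matrices: density matrices and purified distance -/

section Quantum

variable {I : Type*} [Fintype I] [DecidableEq I]

/-- Normalized density matrices. -/
def IsDensityMatrix (ρ : Matrix I I ℂ) : Prop :=
  ρ.PosSemidef ∧ ρ.trace = 1

/-- The trace norm `‖A‖₁ = Tr √(A† A)`. -/
def traceNorm (A : Matrix I I ℂ) : ℝ :=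
  (CFC.sqrt (Aᴴ * A)).trace.re

/-- Generalized fidelity of two sub-normalized density matrices. -/
def fidelity (ρ σ : Matrix I I ℂ) : ℝ :=
  (traceNorm (CFC.sqrt ρ * CFC.sqrt σ) + √((1 - ρ.trace.re) * (1 - σ.trace.re))) ^ 2

/-- Purified distance of two sub-normalized density matrices. -/
def purifiedDistance (ρ σ : Matrix I I ℂ) : ℝ :=
  √(1 - fidelity ρ σ)

/-- The rank-one operator `|v⟩⟨v|`. -/
def ketbra (v : I → ℂ) : Matrix I I ℂ :=
  Matrix.vecMulVec v (star v)

end Quantum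

/-! ## Qubit pairs -/

/-- Two bits.  It indexes the computational basis `|u⟩_A |v⟩_B` of one qubit pair (Alice's bit
first), the four Bell states (phase bit first, amplitude bit second), the two-bit symbols of
Alice's and Bob's random string, and their two measurement outcomes for a pair. -/
abbrev TwoBits : Type := Fin 2 × Fin 2

/-- Matrices of operators on `n` qubit pairs, in the computational basis. -/
abbrev PairsOp (n : ℕ) : Type := Matrix (Fin n → TwoBits) (Fin n → TwoBits) ℂ

/-- The tensor product `⨂ⱼ G j` of operators on the single pairs. -/
def tensorOp {n : ℕ} (G : Fin n → Matrix TwoBits TwoBits ℂ) : PairsOp n :=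
  Matrix.of fun p q => ∏ j, G j (p j) (q j)

/-- The Bell state `(Z^a X^b)_A |φ⁺⟩` with phase bit `a` and amplitude bit `b`:
`(0,0) ↦ φ⁺`, `(1,0) ↦ φ⁻`, `(0,1) ↦ ψ⁺`, `(1,1) ↦ ψ⁻`. -/
def bellVec (x : TwoBits) : TwoBits → ℂ := fun p =>
  if p.1 = p.2 + x.2 then (-1) ^ ((x.1 : ℕ) * (p.1 : ℕ)) / (√2 : ℝ) else 0

/-- The tensor product of the Bell states `x 0, …, x (n-1)`. -/
def bellVecs {n : ℕ} (x : Fin n → TwoBits) : (Fin n → TwoBits) → ℂ := fun p =>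
  ∏ j, bellVec (x j) (p j)

/-- The target state `|Φ⟩⟨Φ|` with `Φ = (φ⁺)^{⊗ n}`. -/
def targetState (n : ℕ) : PairsOp n :=
  ketbra (bellVecs fun _ => (0, 0))

/-- `ρ` is diagonal in the basis of tensor products of Bell states, and `P x` is its eigenvalue
at the Bell product state `x`. -/
def IsBellDiagonalWith {n : ℕ} (ρ : PairsOp n) (P : (Fin n → TwoBits) → ℝ) : Prop :=
  ρ = ∑ x, (P x : ℂ) • ketbra (bellVecs x)

/-! ## The one-way hashing method -/

/-- Rotation `exp(-iθX/2)` of a qubit around the x-axis. -/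
def rotX (θ : ℝ) : Matrix (Fin 2) (Fin 2) ℂ :=
  !![(Real.cos (θ / 2) : ℂ), -Complex.I * (Real.sin (θ / 2) : ℂ);
     -Complex.I * (Real.sin (θ / 2) : ℂ), (Real.cos (θ / 2) : ℂ)]

/-- Rotation `exp(-iθY/2)` of a qubit around the y-axis. -/
def rotY (θ : ℝ) : Matrix (Fin 2) (Fin 2) ℂ :=
  !![(Real.cos (θ / 2) : ℂ), -(Real.sin (θ / 2) : ℂ);
     (Real.sin (θ / 2) : ℂ), (Real.cos (θ / 2) : ℂ)]

/-- What Alice and Bob do on a single pair that carries the symbol `s` (Alice's gate first). -/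
def localGate (s : TwoBits) : Matrix TwoBits TwoBits ℂ :=
  if s = (1, 0) then rotY (Real.pi / 2) ⊗ₖ rotY (Real.pi / 2)
  else if s = (1, 1) then rotX (3 * Real.pi / 2) ⊗ₖ rotX (Real.pi / 2)
  else 1

/-- Both Alice and Bob apply a CNOT gate with control in pair `j` and target in pair `t`:
`|p⟩` goes to the basis vector in which the bits of pair `j` have been added to those of
pair `t`. -/
def bilateralCNOT {n : ℕ} (j t : Fin n) : PairsOp n :=
  Matrix.of fun q p => if q = Function.update p t (p t + p j) then 1 else 0

/-- The position of the first nonzero symbol of `s`; the pair `0` if there is none. -/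
def targetPair {k : ℕ} (s : Fin (k + 1) → TwoBits) : Fin (k + 1) :=
  if h : (Finset.univ.filter fun j => s j ≠ 0).Nonempty then
    (Finset.univ.filter fun j => s j ≠ 0).min' h
  else 0

/-- The unitary that Alice and Bob apply in a round with string `s`, before they measure:
first the local gates, then the (mutually commuting) CNOT gates onto the target pair. -/
def roundUnitary {k : ℕ} (s : Fin (k + 1) → TwoBits) : PairsOp (k + 1) :=
  (((List.finRange (k + 1)).filter fun j => j ≠ targetPair s ∧ s j ≠ 0).map
    fun j => bilateralCNOT j (targetPair s)).prod * tensorOp fun j => localGate (s j)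

/-- One round with string `s` and outcomes `y` (Alice's first) of the measurement of the target
pair in the computational basis: the unnormalized state of the remaining `k` pairs, whose trace
is the probability of `y`. -/
def roundState {k : ℕ} (s : Fin (k + 1) → TwoBits) (y : TwoBits) (ρ : PairsOp (k + 1)) :
    PairsOp k :=
  (roundUnitary s * ρ * (roundUnitary s)ᴴ).submatrix
    (fun p => (targetPair s).insertNth (α := fun _ => TwoBits) y p)
    (fun p => (targetPair s).insertNth (α := fun _ => TwoBits) y p)

/-- The strings used in `r` rounds that leave `m` pairs: entry `k` is used in the round that
starts with `m + k + 1` pairs, so the rounds are run in the order `k = r - 1, …, 0`. -/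
abbrev Strings (m r : ℕ) : Type := ∀ k : Fin r, Fin (m + k + 1) → TwoBits

/-- The measurement outcomes of `r` rounds, indexed as the strings are. -/
abbrev Outcomes (r : ℕ) : Type := Fin r → TwoBits

/-- The unnormalized state of the remaining `m` pairs after `r` rounds with strings `s` and
outcomes `y`, before post-processing; its trace is the probability of `y` given `s`. -/
def stateAfter (m : ℕ) : (r : ℕ) → Strings m r → Outcomes r → PairsOp (m + r) → PairsOp m
  | 0, _, _, ρ => ρ
  | r + 1, s, y, ρ =>
      stateAfter m r (fun k => s k.castSucc) (fun k => y k.castSucc)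
        (roundState (s (Fin.last r)) (y (Fin.last r)) ρ)

/-- The weight `⟨B_x| τ |B_x⟩` of `τ` at the Bell product state `x`; for a Bell-diagonal `τ`,
its eigenvalue there. -/
def bellWeight {m : ℕ} (τ : PairsOp m) (x : Fin m → TwoBits) : ℝ :=
  (star (bellVecs x) ⬝ᵥ τ *ᵥ bellVecs x).re

/-- A Bell product state with the largest eigenvalue (any one, if there are several). -/
def likeliestBell {m : ℕ} (τ : PairsOp m) : Fin m → TwoBits :=
  Classical.choose (Finite.exists_max (bellWeight τ))

/-- The Pauli gate `X`. -/
def pauliX : Matrix (Fin 2) (Fin 2) ℂ := !![0, 1; 1, 0]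

/-- The Pauli gate `Z`. -/
def pauliZ : Matrix (Fin 2) (Fin 2) ℂ := !![1, 0; 0, -1]

/-- Bob applies to his half of each pair `j` the Pauli gate `Z^a X^b` with `(a, b) = x j`.  This
maps the Bell product state `x` to `(φ⁺)^{⊗ m}`, up to a sign. -/
def bobPauli {m : ℕ} (x : Fin m → TwoBits) : PairsOp m :=
  tensorOp fun j =>
    (1 : Matrix (Fin 2) (Fin 2) ℂ) ⊗ₖ (pauliZ ^ ((x j).1 : ℕ) * pauliX ^ ((x j).2 : ℕ))

/-- Post-processing: Bob's Pauli gates move the largest eigenvalue to `(φ⁺)^{⊗ m}`. -/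
def postProcess {m : ℕ} (τ : PairsOp m) : PairsOp m :=
  bobPauli (likeliestBell τ) * τ * (bobPauli (likeliestBell τ))ᴴ

/-- The state of the `m` output pairs of `r` rounds of the one-way hashing method, with uniformly
random strings, after the strings and the outcomes have been traced out. -/
def hashingOutput (m r : ℕ) (ρ : PairsOp (m + r)) : PairsOp m :=
  ∑ s : Strings m r, (Fintype.card (Strings m r) : ℂ)⁻¹ •
    ∑ y : Outcomes r, postProcess (stateAfter m r s y ρ)

/-- Rewriting the number of pairs of a state along an equality. -/
def castPairs {n n' : ℕ} (h : n' = n) (ρ : PairsOp n) : PairsOp n' :=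
  ρ.submatrix (fun p j => p (Fin.cast h.symm j)) (fun p j => p (Fin.cast h.symm j))

/-- `m` Bell pairs can be created from `ρ` by the one-way hashing method, up to a global error
of `ε` in purified distance. -/
def CanDistill {n : ℕ} (ρ : PairsOp n) (ε : ℝ) (m : ℕ) : Prop :=
  ∃ (r : ℕ) (h : m + r = n),
    purifiedDistance (hashingOutput m r (castPairs h ρ)) (targetState m) ≤ ε

/-- The maximal number `m^ε` of Bell pairs, up to error `ε`, that can be created from `ρ` by the
one-way hashing method (the set is bounded by the number `n` of initial pairs). -/
def maxBellPairs {n : ℕ} (ρ : PairsOp n) (ε : ℝ) : ℕ :=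
  sSup {m | CanDistill ρ ε m}

/-- The distillation rate `R^ε = m^ε / n`. -/
def distillationRate {n : ℕ} (ρ : PairsOp n) (ε : ℝ) : ℝ :=
  (maxBellPairs ρ ε : ℝ) / n

end OneWayHashing

end

open OneWayHashing

noncomputable section

namespace OneWayHashing

/-! ### Rank-one operators -/

section Ketbra

variable {I : Type*} [Fintype I]

/-! Since the target is pure, the fidelity is an overlap (`fidelity_ketbra`), and it suffices to
bound from below the weight of the output at `(φ⁺)^{⊗ m}`. The gates send Bell product states to
Bell product states up to phases, and the measurement of a round reveals exactly one bit of the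
label `x`: for `s ≠ 0`, the inner product of `s` and `x` over `𝔽₂` (`roundParity_of_ne_zero`). For
`x ≠ x'` these bits agree for at most half of the strings, so after `r` rounds the two labels are
both undistinguished and in different final states with probability at most `2^{-r}`
(`two_pow_mul_card_collide_le`).

Let `S` be a set of labels. By a union bound, each `x ∈ S` collides with no element of `S` for a
fraction at least `1 - |S| / 2^r` of the strings. For fixed strings and outcomes, all collision-free
labels of `S` compatible with the outcomes lead to one Bell product state, so the largest eigenvalue
is at least their total weight. Hence the overlap is at least `P(S) (1 - |S| / 2^r)`
(`le_bellWeight_hashingOutput`). With `S` the support of an optimal smoothing, Cauchy–Schwarz gives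
`P(S) ≥ 1 - ε₁²`, and the choice of `r` gives `|S| ≤ ε₂² 2^r`; the squared distance is then at most
`ε₁² + ε₂² ≤ ε²`. -/

lemma mul_ketbra_mul_conjTranspose (U : Matrix I I ℂ) (v : I → ℂ) :
    U * ketbra v * Uᴴ = ketbra (U *ᵥ v) := by
  rw [ketbra, ketbra, Matrix.mul_vecMulVec, Matrix.vecMulVec_mul, Matrix.star_mulVec]

lemma ketbra_smul (c : ℂ) (v : I → ℂ) : ketbra (c • v) = (c * star c) • ketbra v := by
  ext i j
  simp [ketbra, Matrix.vecMulVec_apply]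
  ring

lemma ketbra_submatrix {K L : Type*} (v : L → ℂ) (e : K → L) :
    (ketbra v).submatrix e e = ketbra (v ∘ e) := by
  ext i j
  simp [ketbra, Matrix.vecMulVec_apply]

lemma trace_ketbra (v : I → ℂ) : (ketbra v).trace = star v ⬝ᵥ v := by
  rw [ketbra, Matrix.trace_vecMulVec, dotProduct_comm]

lemma posSemidef_ketbra (v : I → ℂ) : (ketbra v).PosSemidef :=
  Matrix.posSemidef_vecMulVec_self_star v

lemma ketbra_mul_mul_ketbra (v : I → ℂ) (A : Matrix I I ℂ) :
    ketbra v * A * ketbra v = (star v ⬝ᵥ A *ᵥ v) • ketbra v := by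
  rw [ketbra, Matrix.vecMulVec_mul, Matrix.vecMulVec_mul_vecMulVec, Matrix.dotProduct_mulVec]
  ext i j
  simp [Matrix.vecMulVec_apply]
  ring

lemma dotProduct_ketbra_mulVec (v w : I → ℂ) :
    star w ⬝ᵥ ketbra v *ᵥ w = (star w ⬝ᵥ v) * (star v ⬝ᵥ w) := by
  rw [ketbra, Matrix.vecMulVec_mulVec]
  simp [mul_comm]

end Ketbra

/-! ### Fidelity with a pure state -/

section PureFidelity

variable {I : Type*} [Fintype I] [DecidableEq I]

lemma sqrt_smul_ketbra {v : I → ℂ} (hv : star v ⬝ᵥ v = 1) {c : ℝ} (hc : 0 ≤ c) :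
    CFC.sqrt ((c : ℂ) • ketbra v) = ((√c : ℝ) : ℂ) • ketbra v := by
  have hmul : ketbra v * ketbra v = ketbra v := by
    classical simpa [hv] using ketbra_mul_mul_ketbra v 1
  apply CFC.sqrt_unique
  · rw [smul_mul_smul_comm, hmul, ← Complex.ofReal_mul, Real.mul_self_sqrt hc]
  · rw [Matrix.nonneg_iff_posSemidef]
    exact (posSemidef_ketbra v).smul (by exact_mod_cast Real.sqrt_nonneg c)

/-- The fidelity with a normalized pure state is the overlap. -/
lemma fidelity_ketbra {ρ : Matrix I I ℂ} (hρ : ρ.PosSemidef) {v : I → ℂ}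
    (hv : star v ⬝ᵥ v = 1) :
    fidelity ρ (ketbra v) = (star v ⬝ᵥ ρ *ᵥ v).re := by
  have h0 : 0 ≤ star v ⬝ᵥ ρ *ᵥ v := hρ.dotProduct_mulVec_nonneg v
  obtain ⟨hre, him⟩ := Complex.nonneg_iff.1 h0
  have hc : star v ⬝ᵥ ρ *ᵥ v = (((star v ⬝ᵥ ρ *ᵥ v).re : ℝ) : ℂ) :=
    Complex.ext (by simp) (by simp [← him])
  have hs : CFC.sqrt (ketbra v) = ketbra v := by
    simpa using sqrt_smul_ketbra hv zero_le_one
  have hS : (CFC.sqrt ρ)ᴴ = CFC.sqrt ρ :=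
    (Matrix.nonneg_iff_posSemidef.1 (CFC.sqrt_nonneg ρ)).isHermitian
  have hSS : CFC.sqrt ρ * CFC.sqrt ρ = ρ :=
    CFC.sqrt_mul_sqrt_self ρ (Matrix.nonneg_iff_posSemidef.2 hρ)
  have htr : (ketbra v).trace = 1 := by rw [trace_ketbra, hv]
  have hT : traceNorm (CFC.sqrt ρ * ketbra v) = √(star v ⬝ᵥ ρ *ᵥ v).re := by
    -- With `A = √ρ |v⟩⟨v|`, the product `A† A` is the overlap times the projection `|v⟩⟨v|`, whose
    -- square root is explicit.
    rw [traceNorm, Matrix.conjTranspose_mul, hS, (posSemidef_ketbra v).isHermitian.eq]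
    rw [show ketbra v * CFC.sqrt ρ * (CFC.sqrt ρ * ketbra v) = ketbra v * ρ * ketbra v by
      rw [← Matrix.mul_assoc, Matrix.mul_assoc (ketbra v), hSS]]
    rw [ketbra_mul_mul_ketbra, hc, sqrt_smul_ketbra hv hre, Matrix.trace_smul, htr]
    simp
  rw [fidelity, hs, hT, htr]
  simp [Real.sq_sqrt hre]

end PureFidelity

/-! ### Bell states -/

lemma ofReal_sqrt_two_mul_self : ((√2 : ℝ) : ℂ) * ((√2 : ℝ) : ℂ) = 2 := by
  rw [← Complex.ofReal_mul, Real.mul_self_sqrt (by norm_num)]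
  norm_num

lemma ofReal_sqrt_two_sq : ((√2 : ℝ) : ℂ) ^ 2 = 2 := by
  rw [sq, ofReal_sqrt_two_mul_self]

lemma ofReal_sqrt_two_ne_zero : ((√2 : ℝ) : ℂ) ≠ 0 := by
  intro h
  have := ofReal_sqrt_two_sq
  simp [h] at this

lemma bellVec_orthonormal (x y : TwoBits) :
    star (bellVec x) ⬝ᵥ bellVec y = if x = y then 1 else 0 := by
  have h := ofReal_sqrt_two_sq
  have h0 := ofReal_sqrt_two_ne_zero
  obtain ⟨a, b⟩ := x
  obtain ⟨c, d⟩ := y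
  fin_cases a <;> fin_cases b <;> fin_cases c <;> fin_cases d <;>
    simp [dotProduct, bellVec, Fintype.sum_prod_type] <;> field_simp <;> rw [h] <;> norm_num

lemma bellVecs_orthonormal {n : ℕ} (x y : Fin n → TwoBits) :
    star (bellVecs x) ⬝ᵥ bellVecs y = if x = y then 1 else 0 := by
  have h : star (bellVecs x) ⬝ᵥ bellVecs y = ∏ j, star (bellVec (x j)) ⬝ᵥ bellVec (y j) := by
    simp only [dotProduct, Fintype.prod_sum, bellVecs, Pi.star_apply, star_prod,
      Finset.prod_mul_distrib]
  rw [h]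
  simp only [bellVec_orthonormal]
  split_ifs with hxy
  · simp [hxy]
  · obtain ⟨j, hj⟩ := Function.ne_iff.1 hxy
    exact Finset.prod_eq_zero (Finset.mem_univ j) (by simp [hj])

lemma star_bellVecs_dotProduct_self {n : ℕ} (x : Fin n → TwoBits) :
    star (bellVecs x) ⬝ᵥ bellVecs x = 1 := by
  simp [bellVecs_orthonormal]

/-- The phase bit only affects signs, so a measurement in the computational basis sees the amplitude
bit alone. -/
lemma bellVec_mul_star (x y : TwoBits) :
    bellVec x y * star (bellVec x y) = if y.1 = y.2 + x.2 then 1 / 2 else 0 := by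
  have h := ofReal_sqrt_two_sq
  have h0 := ofReal_sqrt_two_ne_zero
  rw [bellVec]
  split_ifs
  · simp
    field_simp
    rw [h, ← pow_mul, mul_comm, pow_mul]
    simpa using neg_one_pow_eq_or ℂ _
  · simp

lemma bellWeight_ketbra {n : ℕ} (x z : Fin n → TwoBits) :
    bellWeight (ketbra (bellVecs x)) z = if x = z then 1 else 0 := by
  rw [bellWeight, dotProduct_ketbra_mulVec, bellVecs_orthonormal, bellVecs_orthonormal]
  by_cases h : x = z
  · simp [h]
  · simp [h, Ne.symm h]

lemma bellWeight_sum {n : ℕ} {ι : Type*} (s : Finset ι) (c : ι → ℝ) (τ : ι → PairsOp n)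
    (z : Fin n → TwoBits) :
    bellWeight (∑ i ∈ s, (c i : ℂ) • τ i) z = ∑ i ∈ s, c i * bellWeight (τ i) z := by
  simp [bellWeight, Matrix.sum_mulVec, dotProduct_sum, Matrix.smul_mulVec]

/-! ### Local operations on Bell states -/

lemma tensorOp_mulVec_prod {n : ℕ} (G : Fin n → Matrix TwoBits TwoBits ℂ)
    (v : Fin n → TwoBits → ℂ) :
    (tensorOp G *ᵥ fun p => ∏ j, v j (p j)) = fun p => ∏ j, (G j *ᵥ v j) (p j) := by
  ext p
  simp only [Matrix.mulVec, dotProduct, tensorOp, Matrix.of_apply, Fintype.prod_sum,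
    Finset.prod_mul_distrib]

/-- The action of the local gates on the two bits of a Bell state. -/
def gateBits (s x : TwoBits) : TwoBits :=
  if s = (1, 0) then (x.2, x.1) else if s = (1, 1) then (x.1, x.1 + x.2) else x

lemma rotY_half_pi : rotY (Real.pi / 2) =
    !![((√2 : ℝ) : ℂ) / 2, -(((√2 : ℝ) : ℂ) / 2); ((√2 : ℝ) : ℂ) / 2, ((√2 : ℝ) : ℂ) / 2] := by
  rw [rotY, show Real.pi / 2 / 2 = Real.pi / 4 by ring, Real.cos_pi_div_four,
    Real.sin_pi_div_four]
  simp

lemma rotX_half_pi : rotX (Real.pi / 2) =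
    !![((√2 : ℝ) : ℂ) / 2, -Complex.I * (((√2 : ℝ) : ℂ) / 2);
      -Complex.I * (((√2 : ℝ) : ℂ) / 2), ((√2 : ℝ) : ℂ) / 2] := by
  rw [rotX, show Real.pi / 2 / 2 = Real.pi / 4 by ring, Real.cos_pi_div_four,
    Real.sin_pi_div_four]
  simp

lemma rotX_three_half_pi : rotX (3 * Real.pi / 2) =
    !![-(((√2 : ℝ) : ℂ) / 2), -Complex.I * (((√2 : ℝ) : ℂ) / 2);
      -Complex.I * (((√2 : ℝ) : ℂ) / 2), -(((√2 : ℝ) : ℂ) / 2)] := by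
  rw [rotX, show 3 * Real.pi / 2 / 2 = Real.pi - Real.pi / 4 by ring, Real.cos_pi_sub,
    Real.sin_pi_sub, Real.cos_pi_div_four, Real.sin_pi_div_four]
  simp

lemma rotY_gate_mulVec_bellVec (x : TwoBits) :
    (rotY (Real.pi / 2) ⊗ₖ rotY (Real.pi / 2)) *ᵥ bellVec x =
      (-1 : ℂ) ^ ((x.2 : ℕ) * ((x.1 : ℕ) + 1)) • bellVec (x.2, x.1) := by
  have h := ofReal_sqrt_two_sq
  have h0 := ofReal_sqrt_two_ne_zero
  rw [rotY_half_pi]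
  obtain ⟨a, b⟩ := x
  ext ⟨p, q⟩
  fin_cases a <;> fin_cases b <;> fin_cases p <;> fin_cases q <;>
    simp [Matrix.mulVec, dotProduct, bellVec, Fintype.sum_prod_type] <;>
    field_simp <;> (try rw [h]) <;> norm_num

lemma rotX_gate_mulVec_bellVec (x : TwoBits) :
    (rotX (3 * Real.pi / 2) ⊗ₖ rotX (Real.pi / 2)) *ᵥ bellVec x =
      (if x.1 = 0 then -1 else Complex.I) •
        bellVec (x.1, x.1 + x.2) := by
  have h := ofReal_sqrt_two_sq
  have h0 := ofReal_sqrt_two_ne_zero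
  have hI := Complex.I_sq
  rw [rotX_half_pi, rotX_three_half_pi]
  obtain ⟨a, b⟩ := x
  ext ⟨p, q⟩
  fin_cases a <;> fin_cases b <;> fin_cases p <;> fin_cases q <;>
    simp [Matrix.mulVec, dotProduct, bellVec, Fintype.sum_prod_type] <;>
    field_simp <;> (try rw [h]) <;> (try rw [hI]) <;> norm_num

/-- The phase `c` depends on `x`, but it cancels in `|v⟩⟨v|`, which is all a Bell-diagonal state
needs. -/
lemma exists_localGate_mulVec_bellVec (s x : TwoBits) :
    ∃ c : ℂ, c * star c = 1 ∧ localGate s *ᵥ bellVec x = c • bellVec (gateBits s x) := by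
  unfold localGate gateBits
  split_ifs with h1 h2
  · refine ⟨_, ?_, rotY_gate_mulVec_bellVec x⟩
    rcases neg_one_pow_eq_or ℂ ((x.2 : ℕ) * ((x.1 : ℕ) + 1)) with h | h <;> simp [h]
  · refine ⟨_, ?_, rotX_gate_mulVec_bellVec x⟩
    split_ifs <;> simp
  · exact ⟨1, by simp, by simp⟩

lemma exists_tensorOp_localGate_mulVec_bellVecs {n : ℕ} (s x : Fin n → TwoBits) :
    ∃ c : ℂ, c * star c = 1 ∧ (tensorOp fun j => localGate (s j)) *ᵥ bellVecs x =
      c • bellVecs fun j => gateBits (s j) (x j) := by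
  choose c hc h using fun j => exists_localGate_mulVec_bellVec (s j) (x j)
  refine ⟨∏ j, c j, ?_, ?_⟩
  · rw [star_prod, ← Finset.prod_mul_distrib]
    exact Finset.prod_eq_one fun j _ => hc j
  · refine (tensorOp_mulVec_prod _ _).trans ?_
    ext p
    simp [h, bellVecs, Finset.prod_mul_distrib]

/-- The action of a bilateral CNOT gate from pair `j` to pair `t` on the bits of a Bell product
state. -/
def cnotBits {n : ℕ} (t j : Fin n) (x : Fin n → TwoBits) : Fin n → TwoBits :=
  Function.update (Function.update x t ((x t).1, (x t).2 + (x j).2)) j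
    ((x j).1 + (x t).1, (x j).2)

lemma twoBits_add_self_cancel (a b : TwoBits) : a + b + b = a := by
  revert a b
  decide

lemma bilateralCNOT_mulVec {n : ℕ} {j t : Fin n} (hjt : j ≠ t) (v : (Fin n → TwoBits) → ℂ) :
    bilateralCNOT j t *ᵥ v = fun q => v (Function.update q t (q t + q j)) := by
  ext q
  rw [Matrix.mulVec, dotProduct, Finset.sum_eq_single (Function.update q t (q t + q j))]
  · simp [bilateralCNOT, Function.update_of_ne hjt, twoBits_add_self_cancel]
  · intro p _ hp
    rw [bilateralCNOT, Matrix.of_apply, if_neg, zero_mul]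
    rintro rfl
    apply hp
    simp [Function.update_of_ne hjt, twoBits_add_self_cancel]
  · simp

/-- Amplitude bits propagate from control (`y`) to target (`x`) and phase bits backwards. The
supports match directly; the signs match because their exponents agree modulo 2. -/
lemma bellVec_mul_bellVec_cnot (x y p q : TwoBits) :
    bellVec x (p + q) * bellVec y q =
      bellVec (x.1, x.2 + y.2) p * bellVec (y.1 + x.1, y.2) q := by
  have key : ∀ x y p q : TwoBits,
      ((p + q).1 = (p + q).2 + x.2 ∧ q.1 = q.2 + y.2 ↔
        p.1 = p.2 + (x.2 + y.2) ∧ q.1 = q.2 + y.2) ∧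
      ((x.1 : ℕ) * ((p + q).1 : ℕ) + (y.1 : ℕ) * (q.1 : ℕ)) % 2 =
        ((x.1 : ℕ) * (p.1 : ℕ) + ((y.1 + x.1 : Fin 2) : ℕ) * (q.1 : ℕ)) % 2 := by
    decide
  obtain ⟨h1, h2⟩ := key x y p q
  simp only [bellVec, ite_zero_mul_ite_zero, div_mul_div_comm, ← pow_add]
  simp only [h1]
  rw [neg_one_pow_eq_pow_mod_two, h2, ← neg_one_pow_eq_pow_mod_two]

lemma bilateralCNOT_mulVec_bellVecs {n : ℕ} {j t : Fin n} (hjt : j ≠ t)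
    (x : Fin n → TwoBits) :
    bilateralCNOT j t *ᵥ bellVecs x = bellVecs (cnotBits t j x) := by
  rw [bilateralCNOT_mulVec hjt]
  ext q
  have split : ∀ f : Fin n → ℂ, ∏ i, f i =
      f t * f j * ∏ i ∈ (Finset.univ.erase t).erase j, f i := by
    intro f
    rw [mul_assoc, Finset.mul_prod_erase _ _ (by simp [hjt]),
      Finset.mul_prod_erase _ _ (Finset.mem_univ t)]
  simp only [bellVecs]
  rw [split, split]
  congr 1
  · simpa [cnotBits, Function.update_of_ne hjt, Function.update_of_ne hjt.symm] using
      bellVec_mul_bellVec_cnot (x t) (x j) (q t) (q j)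
  · refine Finset.prod_congr rfl fun i hi => ?_
    simp only [Finset.mem_erase] at hi
    simp [cnotBits, Function.update_of_ne hi.1, Function.update_of_ne hi.2.1]

lemma prod_bilateralCNOT_mulVec_bellVecs {n : ℕ} (t : Fin n) (l : List (Fin n))
    (hl : ∀ j ∈ l, j ≠ t) (x : Fin n → TwoBits) :
    (l.map fun j => bilateralCNOT j t).prod *ᵥ bellVecs x =
      bellVecs (l.foldr (cnotBits t) x) := by
  induction l with
  | nil => simp
  | cons j l ih =>
    rw [List.map_cons, List.prod_cons, ← Matrix.mulVec_mulVec,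
      ih fun i hi => hl i (List.mem_cons_of_mem _ hi),
      bilateralCNOT_mulVec_bellVecs (hl j List.mem_cons_self), List.foldr_cons]

/-- The gates change no amplitude bit of a control pair, so the target just accumulates them. Phase
bits are not tracked, as they do not influence the outcomes. -/
lemma foldr_cnotBits_snd {n : ℕ} (t : Fin n) (l : List (Fin n)) (hl : ∀ j ∈ l, j ≠ t)
    (x : Fin n → TwoBits) :
    (l.foldr (cnotBits t) x t).2 = (x t).2 + (l.map fun j => (x j).2).sum ∧
      ∀ i, i ≠ t → (l.foldr (cnotBits t) x i).2 = (x i).2 := by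
  induction l with
  | nil => simp
  | cons j l ih =>
    obtain ⟨ih1, ih2⟩ := ih fun i hi => hl i (List.mem_cons_of_mem _ hi)
    have hj : j ≠ t := hl j List.mem_cons_self
    constructor
    · rw [List.foldr_cons, cnotBits, Function.update_of_ne hj.symm, Function.update_self]
      simp only [ih1, ih2 j hj, List.map_cons, List.sum_cons]
      abel
    · intro i hi
      rw [List.foldr_cons, cnotBits]
      by_cases hij : i = j
      · subst hij
        simp [ih2 i hi]
      · rw [Function.update_of_ne hij, Function.update_of_ne hi, ih2 i hi]

/-! ### One round on Bell states -/

/-- The action of the gates of a round on the bits of a Bell product state. -/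
def roundBits {k : ℕ} (s x : Fin (k + 1) → TwoBits) : Fin (k + 1) → TwoBits :=
  ((List.finRange (k + 1)).filter fun j => j ≠ targetPair s ∧ s j ≠ 0).foldr
    (cnotBits (targetPair s)) fun j => gateBits (s j) (x j)

/-- The parity bit that is revealed in a round. -/
def roundParity {k : ℕ} (s x : Fin (k + 1) → TwoBits) : Fin 2 :=
  (roundBits s x (targetPair s)).2

/-- The bits of the Bell product state of the pairs that remain after a round. -/
def roundRest {k : ℕ} (s x : Fin (k + 1) → TwoBits) : Fin k → TwoBits :=
  (targetPair s).removeNth (roundBits s x)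

/-- The probability of the outcomes `y` on a Bell state with amplitude bit `b`. -/
def outcomeProb (y : TwoBits) (b : Fin 2) : ℝ :=
  if y.1 = y.2 + b then 1 / 2 else 0

lemma exists_roundUnitary_mulVec_bellVecs {k : ℕ} (s x : Fin (k + 1) → TwoBits) :
    ∃ c : ℂ, c * star c = 1 ∧ roundUnitary s *ᵥ bellVecs x = c • bellVecs (roundBits s x) := by
  obtain ⟨c, hc, h⟩ := exists_tensorOp_localGate_mulVec_bellVecs s x
  refine ⟨c, hc, ?_⟩
  rw [roundUnitary, ← Matrix.mulVec_mulVec, h, Matrix.mulVec_smul,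
    prod_bilateralCNOT_mulVec_bellVecs _ _ (by simp +contextual), roundBits]

lemma bellVecs_insertNth {k : ℕ} (t : Fin (k + 1)) (x : Fin (k + 1) → TwoBits) (y : TwoBits) :
    (bellVecs x ∘ fun p : Fin k → TwoBits => t.insertNth (α := fun _ => TwoBits) y p) =
      bellVec (x t) y • bellVecs (t.removeNth x) := by
  ext p
  simp [bellVecs, Fin.prod_univ_succAbove _ t, Fin.removeNth]

lemma roundState_ketbra_bellVecs {k : ℕ} (s x : Fin (k + 1) → TwoBits) (y : TwoBits) :
    roundState s y (ketbra (bellVecs x)) =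
      (outcomeProb y (roundParity s x) : ℂ) • ketbra (bellVecs (roundRest s x)) := by
  obtain ⟨c, hc, h⟩ := exists_roundUnitary_mulVec_bellVecs s x
  rw [roundState, mul_ketbra_mul_conjTranspose, h, ketbra_smul, hc, one_smul, ketbra_submatrix,
    bellVecs_insertNth, ketbra_smul, bellVec_mul_star, outcomeProb, roundParity, roundRest]
  congr 1
  split_ifs <;> simp

lemma roundState_sum {k : ℕ} (s : Fin (k + 1) → TwoBits) (y : TwoBits) {ι : Type*}
    (t : Finset ι) (c : ι → ℂ) (τ : ι → PairsOp (k + 1)) :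
    roundState s y (∑ i ∈ t, c i • τ i) = ∑ i ∈ t, c i • roundState s y (τ i) := by
  ext p q
  simp [roundState, Finset.mul_sum, Finset.sum_mul, Matrix.sum_apply]

lemma sum_outcomeProb (b : Fin 2) : ∑ y, outcomeProb y b = 1 := by
  fin_cases b <;> simp [outcomeProb, Fintype.sum_prod_type]
  norm_num

lemma outcomeProb_nonneg (y : TwoBits) (b : Fin 2) : 0 ≤ outcomeProb y b := by
  unfold outcomeProb
  split_ifs <;> norm_num

lemma eq_of_outcomeProb_ne_zero {y : TwoBits} {b b' : Fin 2} (h : outcomeProb y b ≠ 0)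
    (h' : outcomeProb y b' ≠ 0) : b = b' := by
  simp only [outcomeProb, ne_eq, ite_eq_right_iff, not_forall] at h h'
  exact add_left_cancel (h.1.symm.trans h'.1)

/-! ### Parities of random strings -/

/-- The local gates are designed to move the bit selected by the symbol into the amplitude position.
For `s = 0` this fails: the gate is trivial while the right side is zero. -/
lemma gateBits_snd (s x : TwoBits) (hs : s ≠ 0) :
    (gateBits s x).2 = s.1 * x.1 + s.2 * x.2 := by
  revert s x
  decide

lemma roundParity_of_ne_zero {k : ℕ} {s : Fin (k + 1) → TwoBits} (hs : s ≠ 0)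
    (x : Fin (k + 1) → TwoBits) :
    roundParity s x = ∑ j, ((s j).1 * (x j).1 + (s j).2 * (x j).2) := by
  have hne : (Finset.univ.filter fun j => s j ≠ 0).Nonempty := by
    obtain ⟨j, hj⟩ := Function.ne_iff.1 hs
    exact ⟨j, by simpa using hj⟩
  have ht : s (targetPair s) ≠ 0 := by
    rw [targetPair, dif_pos hne]
    simpa using Finset.min'_mem _ hne
  rw [roundParity, roundBits, (foldr_cnotBits_snd _ _ (by simp +contextual) _).1,
    gateBits_snd _ _ ht, ← Finset.add_sum_erase _ _ (Finset.mem_univ (targetPair s))]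
  congr 1
  rw [← List.sum_toFinset _ ((List.nodup_finRange _).filter _)]
  -- Pairs left out of the CNOTs carry the symbol zero and contribute nothing to the inner product.
  refine Finset.sum_subset_zero_on_sdiff ?_ ?_ ?_
  · intro j
    simp +contextual
  · intro j hj
    have : s j = 0 := by
      by_contra h
      simp [h] at hj
    simp [this]
  · intro j hj
    exact gateBits_snd _ _ (by simp at hj; exact hj.2)

/-- At a position `j` where `x` and `x'` differ, shifting the symbol `s j` by a suitable `e` changes
the two inner products by different bits. This shift injects the strings with equal inner products
into those with unequal ones. -/
lemma two_mul_card_roundParity_eq_le {k : ℕ} {x x' : Fin (k + 1) → TwoBits} (h : x ≠ x') :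
    2 * (Finset.univ.filter fun s => roundParity s x = roundParity s x').card ≤
      Fintype.card (Fin (k + 1) → TwoBits) := by
  classical
  obtain ⟨j, hj⟩ := Function.ne_iff.1 h
  let ip : (Fin (k + 1) → TwoBits) → (Fin (k + 1) → TwoBits) → Fin 2 := fun s x =>
    ∑ j, ((s j).1 * (x j).1 + (s j).2 * (x j).2)
  obtain ⟨e, he⟩ : ∃ e : TwoBits, ∀ c : TwoBits, ∃ b b' : Fin 2,
      ((c + e).1 * (x j).1 + (c + e).2 * (x j).2 = c.1 * (x j).1 + c.2 * (x j).2 + b) ∧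
      ((c + e).1 * (x' j).1 + (c + e).2 * (x' j).2 = c.1 * (x' j).1 + c.2 * (x' j).2 + b') ∧
      b ≠ b' := by
    generalize x j = u at hj
    generalize x' j = v at hj
    revert u v
    decide
  let φ : (Fin (k + 1) → TwoBits) → (Fin (k + 1) → TwoBits) := fun s =>
    Function.update s j (s j + e)
  have hφ : Function.Injective φ := by
    intro s s' hs
    ext1 i
    have := congrFun hs i
    by_cases hi : i = j
    · subst hi
      simpa [φ] using this
    · simpa [φ, Function.update_of_ne hi] using this
  have hip : ∀ s, ip s x = ip s x' → ip (φ s) x ≠ ip (φ s) x' := by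
    intro s hs
    obtain ⟨b, b', h1, h2, hb⟩ := he (s j)
    have hadd : ∀ (z : Fin (k + 1) → TwoBits) (c : Fin 2),
        ((s j + e).1 * (z j).1 + (s j + e).2 * (z j).2 =
          (s j).1 * (z j).1 + (s j).2 * (z j).2 + c) → ip (φ s) z = ip s z + c := by
      intro z c hc
      simp only [ip]
      rw [← Finset.add_sum_erase _ _ (Finset.mem_univ j),
        ← Finset.add_sum_erase Finset.univ
          (fun i => (s i).1 * (z i).1 + (s i).2 * (z i).2) (Finset.mem_univ j)]
      have : ∀ i ∈ Finset.univ.erase j, (φ s i).1 * (z i).1 + (φ s i).2 * (z i).2 =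
          (s i).1 * (z i).1 + (s i).2 * (z i).2 := by
        intro i hi
        simp [φ, Function.update_of_ne (Finset.ne_of_mem_erase hi)]
      rw [Finset.sum_congr rfl this]
      simp only [φ, Function.update_self]
      rw [hc]
      abel
    rw [hadd x b h1, hadd x' b' h2, hs]
    exact fun h => hb (add_left_cancel h)
  have hsub : (Finset.univ.filter fun s => roundParity s x = roundParity s x') ⊆
      Finset.univ.filter fun s => ip s x = ip s x' := by
    intro s
    simp only [Finset.mem_filter, Finset.mem_univ, true_and]
    intro hs
    -- The string `0` reveals a bit that is not the inner product, but there both inner products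
    -- vanish, so it is counted anyway.
    by_cases h0 : s = 0
    · simp [h0, ip]
    · rwa [roundParity_of_ne_zero h0, roundParity_of_ne_zero h0] at hs
  have himg : ((Finset.univ.filter fun s => ip s x = ip s x').image φ) ⊆
      Finset.univ.filter fun s => ¬ ip s x = ip s x' := by
    intro s hs
    obtain ⟨s', hs', rfl⟩ := Finset.mem_image.1 hs
    simpa using hip s' (by simpa using hs')
  have h1 := Finset.card_le_card hsub
  have h2 := Finset.card_le_card himg
  rw [Finset.card_image_of_injective _ hφ] at h2
  have h3 := Finset.card_filter_add_card_filter_not (s := Finset.univ)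
    (fun s => ip s x = ip s x')
  rw [Finset.card_univ] at h3
  omega

/-! ### Several rounds on Bell states -/

/-- The bits of the Bell product state that remains after `r` rounds with strings `s` on the Bell
product state with bits `x`. -/
def finalBits (m : ℕ) : (r : ℕ) → Strings m r → (Fin (m + r) → TwoBits) → Fin m → TwoBits
  | 0, _, x => x
  | r + 1, s, x => finalBits m r (fun k => s k.castSucc) (roundRest (s (Fin.last r)) x)

/-- The probability of the outcomes `y` in `r` rounds with strings `s` on the Bell product state
with bits `x`. -/
def historyProb (m : ℕ) : (r : ℕ) → Strings m r → Outcomes r → (Fin (m + r) → TwoBits) → ℝ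
  | 0, _, _, _ => 1
  | r + 1, s, y, x =>
      outcomeProb (y (Fin.last r)) (roundParity (s (Fin.last r)) x) *
        historyProb m r (fun k => s k.castSucc) (fun k => y k.castSucc)
          (roundRest (s (Fin.last r)) x)

lemma historyProb_nonneg (m r : ℕ) (s : Strings m r) (y : Outcomes r)
    (x : Fin (m + r) → TwoBits) : 0 ≤ historyProb m r s y x := by
  induction r with
  | zero => exact zero_le_one
  | succ r ih => exact mul_nonneg (outcomeProb_nonneg _ _) (ih _ _ _)

lemma sum_historyProb (m r : ℕ) (s : Strings m r) (x : Fin (m + r) → TwoBits) :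
    ∑ y, historyProb m r s y x = 1 := by
  induction r with
  | zero => simp [historyProb]
  | succ r ih =>
    rw [← (Fin.snocEquiv fun _ : Fin (r + 1) => TwoBits).sum_comp, Fintype.sum_prod_type]
    simp only [historyProb, Fin.snocEquiv, Equiv.coe_fn_mk, Fin.snoc_last, Fin.snoc_castSucc]
    simp only [← Finset.mul_sum]
    refine (Finset.sum_congr rfl fun a _ => congrArg _ (ih _ _)).trans ?_
    simp only [mul_one]
    exact sum_outcomeProb _

lemma stateAfter_sum (m r : ℕ) (s : Strings m r) (y : Outcomes r) {ι : Type*}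
    (t : Finset ι) (c : ι → ℂ) (τ : ι → PairsOp (m + r)) :
    stateAfter m r s y (∑ i ∈ t, c i • τ i) = ∑ i ∈ t, c i • stateAfter m r s y (τ i) := by
  induction r with
  | zero => rfl
  | succ r ih =>
    simp only [stateAfter]
    rw [← ih]
    congr 1
    exact roundState_sum _ _ _ _ _

lemma stateAfter_smul (m r : ℕ) (s : Strings m r) (y : Outcomes r) (c : ℂ)
    (τ : PairsOp (m + r)) : stateAfter m r s y (c • τ) = c • stateAfter m r s y τ := by
  simpa using stateAfter_sum m r s y {()} (fun _ => c) (fun _ => τ)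

lemma stateAfter_ketbra_bellVecs (m r : ℕ) (s : Strings m r) (y : Outcomes r)
    (x : Fin (m + r) → TwoBits) :
    stateAfter m r s y (ketbra (bellVecs x)) =
      (historyProb m r s y x : ℂ) • ketbra (bellVecs (finalBits m r s x)) := by
  induction r with
  | zero => simp [stateAfter, historyProb, finalBits]
  | succ r ih =>
    simp only [stateAfter, historyProb, finalBits]
    have h := roundState_ketbra_bellVecs (s (Fin.last r)) x (y (Fin.last r))
    refine (congrArg _ h).trans ?_
    rw [stateAfter_smul, ih, smul_smul, Complex.ofReal_mul]

lemma posSemidef_roundState {k : ℕ} (s : Fin (k + 1) → TwoBits) (y : TwoBits)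
    {ρ : PairsOp (k + 1)} (hρ : ρ.PosSemidef) : (roundState s y ρ).PosSemidef :=
  (hρ.mul_mul_conjTranspose_same _).submatrix _

lemma posSemidef_stateAfter (m r : ℕ) (s : Strings m r) (y : Outcomes r)
    {ρ : PairsOp (m + r)} (hρ : ρ.PosSemidef) : (stateAfter m r s y ρ).PosSemidef := by
  induction r with
  | zero => exact hρ
  | succ r ih => exact ih _ _ (posSemidef_roundState _ _ hρ)

lemma posSemidef_hashingOutput (m r : ℕ) {ρ : PairsOp (m + r)} (hρ : ρ.PosSemidef) :
    (hashingOutput m r ρ).PosSemidef := by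
  refine Matrix.posSemidef_sum _ fun s _ => Matrix.PosSemidef.smul ?_ ?_
  · refine Matrix.posSemidef_sum _ fun y _ => ?_
    exact (posSemidef_stateAfter m r s y hρ).mul_mul_conjTranspose_same _
  · rw [inv_nonneg]
    positivity

/-! ### Post-processing -/

/-- The adjoint appears because the weight of `U τ U†` at a vector is that of `τ` at its image under
`U†`. -/
lemma pauli_conjTranspose_mulVec_bellVec (x : TwoBits) :
    ((1 : Matrix (Fin 2) (Fin 2) ℂ) ⊗ₖ (pauliZ ^ (x.1 : ℕ) * pauliX ^ (x.2 : ℕ)))ᴴ *ᵥ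
      bellVec (0, 0) = bellVec x := by
  obtain ⟨a, b⟩ := x
  ext ⟨p, q⟩
  fin_cases a <;> fin_cases b <;> fin_cases p <;> fin_cases q <;>
    simp [Matrix.mulVec, dotProduct, bellVec, Fintype.sum_prod_type, pauliX, pauliZ,
      Matrix.one_apply, neg_div]

lemma bobPauli_conjTranspose_mulVec {m : ℕ} (x : Fin m → TwoBits) :
    (bobPauli x)ᴴ *ᵥ bellVecs (fun _ => (0, 0)) = bellVecs x := by
  have h : (bobPauli x)ᴴ = tensorOp fun j =>
      ((1 : Matrix (Fin 2) (Fin 2) ℂ) ⊗ₖ (pauliZ ^ ((x j).1 : ℕ) * pauliX ^ ((x j).2 : ℕ)))ᴴ := by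
    ext p q
    simp [bobPauli, tensorOp, Matrix.conjTranspose_apply]
  rw [h]
  refine (tensorOp_mulVec_prod _ _).trans ?_
  ext p
  simp only [pauli_conjTranspose_mulVec_bellVec, bellVecs]

lemma bellWeight_postProcess {m : ℕ} (τ : PairsOp m) :
    bellWeight (postProcess τ) (fun _ => (0, 0)) = bellWeight τ (likeliestBell τ) := by
  rw [bellWeight, postProcess, ← Matrix.mulVec_mulVec, ← Matrix.mulVec_mulVec,
    Matrix.dotProduct_mulVec, ← Matrix.conjTranspose_conjTranspose (bobPauli _),
    ← Matrix.star_mulVec, Matrix.conjTranspose_conjTranspose, bobPauli_conjTranspose_mulVec,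
    bellWeight]

lemma bellWeight_le_postProcess {m : ℕ} (τ : PairsOp m) (z : Fin m → TwoBits) :
    bellWeight τ z ≤ bellWeight (postProcess τ) (fun _ => (0, 0)) := by
  rw [bellWeight_postProcess]
  exact Classical.choose_spec (Finite.exists_max (bellWeight τ)) z

/-! ### Collisions -/

/-- With strings `s`, the Bell product states `x` and `x'` can produce the same outcomes, but end
up in different states. -/
def Collide (m r : ℕ) (s : Strings m r) (x x' : Fin (m + r) → TwoBits) : Prop :=
  (∃ y, historyProb m r s y x ≠ 0 ∧ historyProb m r s y x' ≠ 0) ∧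
    finalBits m r s x ≠ finalBits m r s x'

lemma Collide.of_succ {m r : ℕ} {s : Strings m (r + 1)} {x x' : Fin (m + (r + 1)) → TwoBits}
    (h : Collide m (r + 1) s x x') :
    roundParity (s (Fin.last r)) x = roundParity (s (Fin.last r)) x' ∧
      Collide m r (fun k => s k.castSucc) (roundRest (s (Fin.last r)) x)
        (roundRest (s (Fin.last r)) x') := by
  obtain ⟨⟨y, hy, hy'⟩, hne⟩ := h
  exact ⟨eq_of_outcomeProb_ne_zero (left_ne_zero_of_mul hy) (left_ne_zero_of_mul hy'),
    ⟨_, right_ne_zero_of_mul hy, right_ne_zero_of_mul hy'⟩, hne⟩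

open Classical in
-- Each round with distinct labels contributes a factor `1/2`, since a collision requires equal
-- parities; once the labels coincide, no collision is possible. The strings of different rounds are
-- independent.
lemma two_pow_mul_card_collide_le (m r : ℕ) (x x' : Fin (m + r) → TwoBits) :
    2 ^ r * (Finset.univ.filter fun s => Collide m r s x x').card ≤
      Fintype.card (Strings m r) := by
  induction r with
  | zero =>
    rw [pow_zero, one_mul]
    exact Finset.card_le_univ _
  | succ r ih =>
    by_cases hx : x = x'
    · subst hx
      simp [Collide]
    let e := Fin.snocEquiv fun k : Fin (r + 1) => (Fin (m + k + 1) → TwoBits)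
    let A := Finset.univ.filter fun a : Fin (m + r + 1) → TwoBits =>
      roundParity a x = roundParity a x'
    have hcard : Fintype.card (Strings m (r + 1)) =
        Fintype.card (Fin (m + r + 1) → TwoBits) * Fintype.card (Strings m r) := by
      rw [← Fintype.card_congr e, Fintype.card_prod]
      rfl
    have hle : (Finset.univ.filter fun s => Collide m (r + 1) s x x').card ≤
        ∑ a ∈ A, (Finset.univ.filter fun s : Strings m r =>
          Collide m r s (roundRest a x) (roundRest a x')).card := by
      rw [← Finset.card_sigma]
      refine Finset.card_le_card_of_injOn
        (fun s => ⟨s (Fin.last r), fun k => s k.castSucc⟩) ?_ ?_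
      · intro s hs
        have h := Collide.of_succ (by simpa using hs)
        simp only [Finset.coe_sigma, Set.mem_sigma_iff, A, Finset.mem_coe, Finset.mem_filter,
          Finset.mem_univ, true_and]
        exact h
      · intro s _ s' _ h
        simp only [Sigma.mk.injEq, heq_eq_eq] at h
        funext k
        refine Fin.lastCases ?_ (fun i => ?_) k
        · exact h.1
        · exact congrFun h.2 i
    have hA : 2 * A.card ≤ Fintype.card (Fin (m + r + 1) → TwoBits) :=
      two_mul_card_roundParity_eq_le hx
    calc 2 ^ (r + 1) * (Finset.univ.filter fun s => Collide m (r + 1) s x x').card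
        ≤ 2 ^ (r + 1) * ∑ a ∈ A, (Finset.univ.filter fun s : Strings m r =>
          Collide m r s (roundRest a x) (roundRest a x')).card := Nat.mul_le_mul_left _ hle
      _ = 2 * ∑ a ∈ A, 2 ^ r * (Finset.univ.filter fun s : Strings m r =>
          Collide m r s (roundRest a x) (roundRest a x')).card := by
        rw [← Finset.mul_sum, pow_succ]
        ring
      _ ≤ 2 * ∑ _a ∈ A, Fintype.card (Strings m r) :=
        Nat.mul_le_mul_left _ (Finset.sum_le_sum fun a _ => ih _ _)
      _ = 2 * A.card * Fintype.card (Strings m r) := by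
        rw [Finset.sum_const, smul_eq_mul, mul_assoc]
      _ ≤ _ := by
        rw [hcard]
        exact Nat.mul_le_mul_right _ hA

/-! ### Overlap of the output with the target -/

open Classical in
-- The largest eigenvalue dominates the weight at the single state `z` in which all contributing
-- labels end.
lemma sum_le_bellWeight_postProcess (m r : ℕ) (s : Strings m r) (y : Outcomes r)
    (P : (Fin (m + r) → TwoBits) → ℝ) (hP : ∀ x, 0 ≤ P x) (S : Finset (Fin (m + r) → TwoBits)) :
    ∑ x ∈ S with ∀ x' ∈ S, ¬ Collide m r s x x', P x * historyProb m r s y x ≤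
      bellWeight (postProcess (stateAfter m r s y (∑ x, (P x : ℂ) • ketbra (bellVecs x))))
        (fun _ => (0, 0)) := by
  set τ := stateAfter m r s y (∑ x, (P x : ℂ) • ketbra (bellVecs x)) with hτ
  have hw : ∀ z, bellWeight τ z =
      ∑ x, P x * historyProb m r s y x * if finalBits m r s x = z then 1 else 0 := by
    intro z
    rw [hτ, stateAfter_sum]
    simp only [stateAfter_ketbra_bellVecs, smul_smul, ← Complex.ofReal_mul]
    rw [bellWeight_sum]
    simp only [bellWeight_ketbra]
  have hterm : ∀ x, 0 ≤ P x * historyProb m r s y x := fun x =>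
    mul_nonneg (hP x) (historyProb_nonneg _ _ _ _ _)
  have hnonneg : ∀ z x, 0 ≤ P x * historyProb m r s y x *
      if finalBits m r s x = z then (1 : ℝ) else 0 := by
    intro z x
    refine mul_nonneg (hterm x) ?_
    split_ifs <;> norm_num
  obtain ⟨z, hz⟩ : ∃ z, ∀ x ∈ S.filter (fun x => ∀ x' ∈ S, ¬ Collide m r s x x'),
      historyProb m r s y x ≠ 0 → finalBits m r s x = z := by
    -- Any compatible `x₀ ∈ S` determines `z`; it need not be collision-free itself. If none is
    -- compatible, all terms vanish and `z` is arbitrary.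
    by_cases h : ∃ x ∈ S, historyProb m r s y x ≠ 0
    · obtain ⟨x₀, hx₀, h₀⟩ := h
      refine ⟨finalBits m r s x₀, fun x hx h => ?_⟩
      by_contra hne
      exact (Finset.mem_filter.1 hx).2 x₀ hx₀ ⟨⟨y, h, h₀⟩, hne⟩
    · push Not at h
      exact ⟨fun _ => 0, fun x hx h' => absurd (h x (Finset.mem_filter.1 hx).1) h'⟩
  refine le_trans ?_ (bellWeight_le_postProcess τ z)
  rw [hw]
  refine le_trans (Finset.sum_le_sum fun x hx => ?_)
    (Finset.sum_le_sum_of_subset_of_nonneg (Finset.subset_univ _) fun x _ _ => hnonneg z x)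
  by_cases h : historyProb m r s y x = 0
  · simp [h]
  · simp [hz x hx h]

open Classical in
/-- If `S` carries most of the weight of `P` and has few elements compared to `2 ^ r`, then the
output of `r` rounds has a large overlap with the target state. -/
lemma le_bellWeight_hashingOutput (m r : ℕ) (P : (Fin (m + r) → TwoBits) → ℝ)
    (hP : ∀ x, 0 ≤ P x) (S : Finset (Fin (m + r) → TwoBits)) :
    (∑ x ∈ S, P x) * (1 - (S.card : ℝ) / 2 ^ r) ≤
      bellWeight (hashingOutput m r (∑ x, (P x : ℂ) • ketbra (bellVecs x)))
        (fun _ => (0, 0)) := by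
  set N : ℝ := (Fintype.card (Strings m r) : ℝ) with hN
  have hNpos : 0 < N := by
    rw [hN]
    exact_mod_cast Fintype.card_pos
  have hexp : bellWeight (hashingOutput m r (∑ x, (P x : ℂ) • ketbra (bellVecs x)))
      (fun _ => (0, 0)) = ∑ s, N⁻¹ * ∑ y, bellWeight (postProcess (stateAfter m r s y
        (∑ x, (P x : ℂ) • ketbra (bellVecs x)))) (fun _ => (0, 0)) := by
    have h1 : ∀ s, bellWeight (∑ y, postProcess (stateAfter m r s y
        (∑ x, (P x : ℂ) • ketbra (bellVecs x)))) (fun _ => (0, 0)) =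
        ∑ y, bellWeight (postProcess (stateAfter m r s y
        (∑ x, (P x : ℂ) • ketbra (bellVecs x)))) (fun _ => (0, 0)) := by
      intro s
      have := bellWeight_sum Finset.univ (fun _ => 1) (fun y => postProcess (stateAfter m r s y
        (∑ x, (P x : ℂ) • ketbra (bellVecs x)))) (fun _ => (0, 0))
      simpa using this
    simp only [← h1]
    rw [← bellWeight_sum]
    simp [hashingOutput, hN]
  have hgood : ∀ x ∈ S, N * (1 - (S.card : ℝ) / 2 ^ r) ≤
      (Finset.univ.filter fun s => ∀ x' ∈ S, ¬ Collide m r s x x').card := by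
    intro x _
    have hsplit := Finset.card_filter_add_card_filter_not (s := Finset.univ)
      (fun s => ∀ x' ∈ S, ¬ Collide m r s x x')
    have hbad : (Finset.univ.filter fun s => ¬ ∀ x' ∈ S, ¬ Collide m r s x x') ⊆
        S.biUnion fun x' => Finset.univ.filter fun s => Collide m r s x x' := by
      intro s hs
      simpa using hs
    have h1 := (Finset.card_le_card hbad).trans Finset.card_biUnion_le
    have h2 : 2 ^ r * (Finset.univ.filter fun s => ¬ ∀ x' ∈ S, ¬ Collide m r s x x').card ≤
        S.card * Fintype.card (Strings m r) := by
      refine (Nat.mul_le_mul_left _ h1).trans ?_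
      rw [Finset.mul_sum, ← smul_eq_mul (S.card), ← Finset.sum_const]
      exact Finset.sum_le_sum fun x' _ => two_pow_mul_card_collide_le m r x x'
    have h3 : (2 : ℝ) ^ r * (Finset.univ.filter fun s =>
        ¬ ∀ x' ∈ S, ¬ Collide m r s x x').card ≤ S.card * N := by
      rw [hN]
      exact_mod_cast h2
    have h4 : ((Finset.univ.filter fun s => ∀ x' ∈ S, ¬ Collide m r s x x').card : ℝ) +
        (Finset.univ.filter fun s => ¬ ∀ x' ∈ S, ¬ Collide m r s x x').card = N := by
      rw [hN, ← Finset.card_univ]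
      exact_mod_cast hsplit
    have h5 : ((Finset.univ.filter fun s => ¬ ∀ x' ∈ S, ¬ Collide m r s x x').card : ℝ) ≤
        N * (S.card / 2 ^ r) := by
      rw [← mul_div_assoc, le_div_iff₀ (by positivity)]
      linarith
    linarith
  rw [hexp, ← Finset.mul_sum, inv_mul_eq_div, le_div_iff₀ hNpos]
  calc (∑ x ∈ S, P x) * (1 - (S.card : ℝ) / 2 ^ r) * N
      = ∑ x ∈ S, P x * (N * (1 - (S.card : ℝ) / 2 ^ r)) := by
        rw [← Finset.sum_mul]
        ring
    _ ≤ ∑ x ∈ S, P x *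
        (Finset.univ.filter fun s => ∀ x' ∈ S, ¬ Collide m r s x x').card :=
        Finset.sum_le_sum fun x hx => mul_le_mul_of_nonneg_left (hgood x hx) (hP x)
    _ = ∑ s, ∑ x ∈ S with ∀ x' ∈ S, ¬ Collide m r s x x', P x := by
        simp only [Finset.sum_filter]
        rw [Finset.sum_comm]
        refine Finset.sum_congr rfl fun x _ => ?_
        rw [← Finset.sum_filter, Finset.sum_const, nsmul_eq_mul, mul_comm]
    _ = ∑ s, ∑ y, ∑ x ∈ S with ∀ x' ∈ S, ¬ Collide m r s x x',
          P x * historyProb m r s y x := by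
        refine Finset.sum_congr rfl fun s _ => ?_
        rw [Finset.sum_comm]
        refine Finset.sum_congr rfl fun x _ => ?_
        rw [← Finset.mul_sum, sum_historyProb, mul_one]
    _ ≤ _ := Finset.sum_le_sum fun s _ => Finset.sum_le_sum fun y _ =>
        sum_le_bellWeight_postProcess m r s y P hP S

/-! ### The smooth Hartley entropy -/

section SmoothHartley

variable {X : Type*} [Fintype X]

open Classical in
-- Cauchy–Schwarz on the support of `Q`; the defect term of the fidelity vanishes because `P` is
-- normalized.
lemma classicalFidelity_le_sum_support {P Q : X → ℝ} (hP : ∀ x, 0 ≤ P x) (hP1 : ∑ x, P x = 1)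
    (hQ : IsSubDistribution Q) :
    classicalFidelity P Q ≤ ∑ x with 0 < Q x, P x := by
  have h0 : ∑ x, √(P x * Q x) = ∑ x with 0 < Q x, √(P x) * √(Q x) := by
    rw [Finset.sum_filter]
    refine Finset.sum_congr rfl fun x _ => ?_
    split_ifs with h
    · exact Real.sqrt_mul (hP x) _
    · simp [le_antisymm (not_lt.1 h) (hQ.1 x)]
  have hSP : 0 ≤ ∑ x with 0 < Q x, P x := Finset.sum_nonneg fun x _ => hP x
  have hSQ : ∑ x with 0 < Q x, Q x ≤ 1 :=
    (Finset.sum_le_sum_of_subset_of_nonneg (Finset.subset_univ _) fun x _ _ => hQ.1 x).trans hQ.2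
  have hcs := Real.sum_sqrt_mul_sqrt_le (Finset.univ.filter fun x => 0 < Q x) hP hQ.1
  have hle : ∑ x with 0 < Q x, √(P x) * √(Q x) ≤ √(∑ x with 0 < Q x, P x) :=
    hcs.trans (mul_le_of_le_one_right (Real.sqrt_nonneg _) (Real.sqrt_le_one.2 hSQ))
  have hnn : 0 ≤ ∑ x with 0 < Q x, √(P x) * √(Q x) :=
    Finset.sum_nonneg fun x _ => by positivity
  rw [classicalFidelity, h0, hP1]
  simp only [sub_self, zero_mul, Real.sqrt_zero, add_zero]
  calc _ ≤ √(∑ x with 0 < Q x, P x) ^ 2 := pow_le_pow_left₀ hnn hle 2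
    _ = _ := Real.sq_sqrt hSP

/-- The smooth Hartley entropy is the logarithm of the size of a set of probability at least
`1 - ε ^ 2`. -/
lemma exists_smoothHartleyEntropy_eq {P : X → ℝ} (hP : ∀ x, 0 ≤ P x) (hP1 : ∑ x, P x = 1)
    {ε : ℝ} (hε : 0 < ε) (hε' : ε < 1) :
    ∃ S : Finset X, 0 < S.card ∧ smoothHartleyEntropy ε P = Real.logb 2 S.card ∧
      1 - ε ^ 2 ≤ ∑ x ∈ S, P x := by
  classical
  have hne : (hartleyEntropy '' classicalBall ε P).Nonempty := by
    refine ⟨_, P, ⟨⟨hP, hP1.le⟩, ?_⟩, rfl⟩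
    simp [classicalPurifiedDistance, classicalFidelity, hP1, Real.sqrt_mul_self (hP _), hε.le]
  -- The entropy depends only on the support, so it takes finitely many values and the infimum is
  -- attained.
  have hfin : (hartleyEntropy '' classicalBall ε P).Finite := by
    refine ((Set.finite_range fun S : Set X => Real.logb 2 S.ncard)).subset ?_
    rintro _ ⟨Q, _, rfl⟩
    exact ⟨_, rfl⟩
  obtain ⟨Q, ⟨hQ, hd⟩, hEq⟩ := hne.csInf_mem hfin
  have hsum : 1 - ε ^ 2 ≤ ∑ x with 0 < Q x, P x := by
    have h1 := (Real.sqrt_le_iff.1 hd).2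
    have h2 := classicalFidelity_le_sum_support hP hP1 hQ
    linarith
  refine ⟨Finset.univ.filter fun x => 0 < Q x, ?_, ?_, hsum⟩
  · rw [Finset.card_pos, Finset.nonempty_iff_ne_empty]
    intro h
    rw [h, Finset.sum_empty] at hsum
    nlinarith
  · rw [smoothHartleyEntropy, ← hEq, hartleyEntropy, ← Set.ncard_coe_finset]
    simp

end SmoothHartley

/-! ### Distillation -/

lemma IsBellDiagonalWith.bellWeight_eq {n : ℕ} {ρ : PairsOp n} {P : (Fin n → TwoBits) → ℝ}
    (h : IsBellDiagonalWith ρ P) (x : Fin n → TwoBits) : bellWeight ρ x = P x := by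
  rw [h, bellWeight_sum]
  simp [bellWeight_ketbra]

lemma IsBellDiagonalWith.nonneg {n : ℕ} {ρ : PairsOp n} {P : (Fin n → TwoBits) → ℝ}
    (h : IsBellDiagonalWith ρ P) (hρ : ρ.PosSemidef) (x : Fin n → TwoBits) : 0 ≤ P x := by
  rw [← h.bellWeight_eq x]
  exact (Complex.nonneg_iff.1 (hρ.dotProduct_mulVec_nonneg (bellVecs x))).1

lemma IsBellDiagonalWith.sum_eq_one {n : ℕ} {ρ : PairsOp n} {P : (Fin n → TwoBits) → ℝ}
    (h : IsBellDiagonalWith ρ P) (hρ : ρ.trace = 1) : ∑ x, P x = 1 := by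
  rw [h, Matrix.trace_sum] at hρ
  simp only [Matrix.trace_smul, trace_ketbra, star_bellVecs_dotProduct_self, smul_eq_mul,
    mul_one] at hρ
  exact_mod_cast hρ

lemma purifiedDistance_targetState {m : ℕ} {ρ : PairsOp m} (hρ : ρ.PosSemidef) :
    purifiedDistance ρ (targetState m) = √(1 - bellWeight ρ fun _ => (0, 0)) := by
  rw [purifiedDistance, targetState, fidelity_ketbra hρ (star_bellVecs_dotProduct_self _),
    bellWeight]

lemma canDistill_of_card_le {m r : ℕ} {ρ : PairsOp (m + r)} (hρ : IsDensityMatrix ρ)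
    {P : (Fin (m + r) → TwoBits) → ℝ} (hP : IsBellDiagonalWith ρ P) {ε ε₁ ε₂ : ℝ}
    (hε₁ : 0 ≤ ε₁) (hε₂ : 0 ≤ ε₂) (hε : ε₁ + ε₂ ≤ ε)
    (S : Finset (Fin (m + r) → TwoBits)) (hS : 1 - ε₁ ^ 2 ≤ ∑ x ∈ S, P x)
    (hcard : (S.card : ℝ) ≤ ε₂ ^ 2 * 2 ^ r) : CanDistill ρ ε m := by
  refine ⟨r, rfl, ?_⟩
  have hcast : castPairs rfl ρ = ρ := rfl
  rw [hcast, purifiedDistance_targetState (posSemidef_hashingOutput m r hρ.1), Real.sqrt_le_iff]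
  have hnn := hP.nonneg hρ.1
  have h := le_bellWeight_hashingOutput m r P hnn S
  rw [← show ρ = ∑ x, (P x : ℂ) • ketbra (bellVecs x) from hP] at h
  have hSle : ∑ x ∈ S, P x ≤ 1 := by
    rw [← hP.sum_eq_one hρ.2]
    exact Finset.sum_le_sum_of_subset_of_nonneg (Finset.subset_univ _) fun x _ _ => hnn x
  have hS0 : 0 ≤ ∑ x ∈ S, P x := Finset.sum_nonneg fun x _ => hnn x
  have hdiv : (S.card : ℝ) / 2 ^ r ≤ ε₂ ^ 2 := by
    rwa [div_le_iff₀ (by positivity)]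
  refine ⟨by linarith, ?_⟩
  have h1 : (∑ x ∈ S, P x) * ((S.card : ℝ) / 2 ^ r) ≤ ε₂ ^ 2 :=
    (mul_le_of_le_one_left (by positivity) hSle).trans hdiv
  have h2 : (ε₁ + ε₂) ^ 2 ≤ ε ^ 2 := pow_le_pow_left₀ (by linarith) hε 2
  have h3 : 0 ≤ ε₁ * ε₂ := mul_nonneg hε₁ hε₂
  nlinarith

lemma CanDistill.le_maxBellPairs {n : ℕ} {ρ : PairsOp n} {ε : ℝ} {m : ℕ}
    (h : CanDistill ρ ε m) : m ≤ maxBellPairs ρ ε := by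
  -- Boundedness matters: `sSup` of an unbounded set of naturals is `0` by default.
  refine le_csSup ⟨n, ?_⟩ h
  rintro k ⟨r, hr, _⟩
  omega

lemma sub_ceil_le_maxBellPairs {n : ℕ} {ρ : PairsOp n} (hρ : IsDensityMatrix ρ)
    {P : (Fin n → TwoBits) → ℝ} (hP : IsBellDiagonalWith ρ P) {ε ε₁ ε₂ : ℝ}
    (hε₁ : 0 < ε₁) (hε₁' : ε₁ < 1) (hε₂ : 0 < ε₂) (hε₂' : ε₂ ≤ 1) (hε : ε₁ + ε₂ ≤ ε) :
    (n : ℤ) - ⌈smoothHartleyEntropy ε₁ P - 2 * Real.logb 2 ε₂⌉ ≤ (maxBellPairs ρ ε : ℤ) := by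
  obtain ⟨S, hS0, hH, hS⟩ := exists_smoothHartleyEntropy_eq (hP.nonneg hρ.1)
    (hP.sum_eq_one hρ.2) hε₁ hε₁'
  have hScard : (0 : ℝ) < S.card := by exact_mod_cast hS0
  have hS1 : (1 : ℝ) ≤ S.card := by exact_mod_cast hS0
  have hnonneg : 0 ≤ smoothHartleyEntropy ε₁ P - 2 * Real.logb 2 ε₂ := by
    have h1 := Real.logb_nonneg one_lt_two hS1
    have h2 := Real.logb_nonpos one_lt_two hε₂.le hε₂'
    linarith
  -- The number of rounds is the ceiling itself, which makes `|S| / ε₂² ≤ 2^r`. If it exceeds `n`,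
  -- the claimed bound is negative and holds trivially.
  obtain ⟨r, hr⟩ := Int.eq_ofNat_of_zero_le (Int.ceil_nonneg hnonneg)
  rw [hr]
  rcases le_or_gt r n with hrn | hrn
  · obtain ⟨m, rfl⟩ := Nat.exists_eq_add_of_le' hrn
    have hle : Real.logb 2 (S.card / ε₂ ^ 2) ≤ r := by
      rw [Real.logb_div hScard.ne' (by positivity), Real.logb_pow, ← hH]
      have := Int.le_ceil (smoothHartleyEntropy ε₁ P - 2 * Real.logb 2 ε₂)
      rw [hr] at this
      exact_mod_cast this
    have hcard : (S.card : ℝ) ≤ ε₂ ^ 2 * 2 ^ r := by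
      rw [Real.logb_le_iff_le_rpow one_lt_two (by positivity), Real.rpow_natCast,
        div_le_iff₀ (by positivity)] at hle
      linarith
    have := (canDistill_of_card_le hρ hP hε₁.le hε₂.le hε S hS hcard).le_maxBellPairs
    push_cast
    omega
  · omega

end OneWayHashing

end

theorem theorem1 (n : ℕ) (ρ : PairsOp n) (hρ : IsDensityMatrix ρ)
    (P : (Fin n → TwoBits) → ℝ) (hP : IsBellDiagonalWith ρ P)
    (ε ε₁ ε₂ : ℝ) (hε₁ : 0 < ε₁) (hε₁' : ε₁ < 1) (hε₂ : 0 < ε₂) (hε₂' : ε₂ ≤ 1)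
    (hε : ε₁ + ε₂ ≤ ε) :
    (n : ℤ) - ⌈smoothHartleyEntropy ε₁ P - 2 * Real.logb 2 ε₂⌉ ≤ (maxBellPairs ρ ε : ℤ) ∧
    ((n : ℝ) - (⌈smoothHartleyEntropy ε₁ P - 2 * Real.logb 2 ε₂⌉ : ℝ)) / (n : ℝ) ≤
      distillationRate ρ ε := by
  have h := sub_ceil_le_maxBellPairs hρ hP hε₁ hε₁' hε₂ hε₂' hε
  refine ⟨h, ?_⟩
  rw [distillationRate]
  gcongr
  exact_mod_cast h
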